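/- Fix the following notions. Identifiers are drawn from a countable supply, say $\mathbb{N}$; every instance uses finitely many of them. An interval is a triple $(\eta,s,e)$ with $\eta$ an identifier and $s\le e$ in $\mathbb{N}$; write $\mathrm{id},\mathrm{s},\mathrm{e}$ for its components. A pool is a set of intervals. A trace is a finite sequence $(\eta_0,t_0)\cdots(\eta_{n-1},t_{n-1})$ of events (identifier, timestamp in $\mathbb{N}$) with $t_i\le t_j$ for $i<j$; it induces the pool of all $(\eta_k,t_k,t_k)$. A data-free nfer rule is either inclusive, $\eta\leftarrow\eta_1\oplus\eta_2$ with $\oplus\in\{$before, meet, during, coincide, start, finish, overlap, slice$\}$, or exclusive, $\eta\leftarrow\eta_1\ \mathrm{unless}\ \ominus\ \eta_2$ with $\ominus\in\{$after, follow, contain$\}$. On a pool $\pi$, an inclusive rule $\delta$ produces the set $R[\delta]\pi$ of all $\eta$-labeled intervals $i$ for which there are $i_1,i_2\in\pi$ labeled $\eta_1,\eta_2$ with $\oplus(i,i_1,i_2)$, where - before: $\mathrm e(i_1)<\mathrm s(i_2)$, $\mathrm s(i)=\mathrm s(i_1)$, $\mathrm e(i)=\mathrm e(i_2)$; - meet: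 $\mathrm e(i_1)=\mathrm s(i_2)$, $\mathrm s(i)=\mathrm s(i_1)$, $\mathrm e(i)=\mathrm e(i_2)$; - during: $\mathrm s(i_2)=\mathrm s(i)\le \mathrm s(i_1)$, $\mathrm e(i_1)\le \mathrm e(i_2)=\mathrm e(i)$; - coincide: $\mathrm s(i_1)=\mathrm s(i_2)=\mathrm s(i)$, $\mathrm e(i_1)=\mathrm e(i_2)=\mathrm e(i)$; - start: $\mathrm s(i_1)=\mathrm s(i_2)=\mathrm s(i)$, $\mathrm e(i)=\max(\mathrm e(i_1),\mathrm e(i_2))$; - finish: $\mathrm e(i)=\mathrm e(i_1)=\mathrm e(i_2)$, $\mathrm s(i)=\min(\mathrm s(i_1),\mathrm s(i_2))$; - overlap: $\mathrm s(i_1)<\mathrm e(i_2)$, $\mathrm s(i_2)<\mathrm e(i_1)$, $\mathrm s(i)=\min(\mathrm s(i_1),\mathrm s(i_2))$, $\mathrm e(i)=\max(\mathrm e(i_1),\mathrm e(i_2))$; - slice: $\mathrm s(i_1)<\mathrm e(i_2)$, $\mathrm s(i_2)<\mathrm e(i_1)$, $\mathrm s(i)=\max(\mathrm s(i_1),\mathrm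 s(i_2))$, $\mathrm e(i)=\min(\mathrm e(i_1),\mathrm e(i_2))$. An exclusive rule produces all $(\eta,\mathrm s(i_1),\mathrm e(i_1))$ with $i_1\in\pi$ labeled $\eta_1$ such that no $\eta_2$-labeled $i_2\in\pi$ with $i_2\neq i_1$ satisfies $\ominus(i_1,i_2)$, where after means $\mathrm s(i_1)>\mathrm e(i_2)$, follow means $\mathrm s(i_1)=\mathrm e(i_2)$, and contain means $\mathrm s(i_2)\ge \mathrm s(i_1)$ and $\mathrm e(i_2)\le \mathrm e(i_1)$. A specification $D$ is a finite list of rules. Its graph $G(D)$ has the rules as vertices and an edge from $\delta$ to $\delta'$ iff the left-hand identifier $\eta$ of $\delta$ is one of the right-hand identifiers $\eta_1,\eta_2$ of $\delta'$. $D$ is cycle-free if $G(D)$ has no directed cycle (loops count as cycles). For a trace $\tau$, the pool $T[D]\tau$ is obtained from the pool of $\tau$ by going through the strongly connected components of $G(D)$ in a topological order and, for each of them, repeatedly replacing the current pool $\pi$ by $\pi\cup R[\delta]\pi$ for the rules $\delta$ of the component, in turn, until a fixed point is reached. (If $D$ is cycle-free, the components are single rules.) $D$ is satisfiable for a finite set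 $\Sigma$ of input identifiers and a target identifier $\eta_T$ if there is a non-empty trace $\tau$ with identifiers in $\Sigma$ such that $T[D]\tau$ contains an $\eta_T$-labeled interval. **Theorem 3.** The satisfiability problem for cycle-free data-free nfer is decidable: there is an algorithm that, given a specification $D$ of inclusive and exclusive rules, a finite set $\Sigma$ of identifiers and an identifier $\eta_T$, decides whether $D$ is cycle-free and satisfiable for $\Sigma$ and $\eta_T$. -/

import Mathlib

namespace Nfer

/-- Identifiers. Every finite alphabet of identifiers is identified with a finite set of natural
numbers, so that specifications over arbitrary finite alphabets are inputs of one problem. -/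
abbrev Ident : Type := ℕ

/-- The operators of inclusive rules. -/
inductive InclOp : Type
  | before | meet | during | coincide | start | finish | overlap | slice

/-- The operators of exclusive rules. -/
inductive ExclOp : Type
  | after | follow | contain

/-- A rule `lhs ← rhs₁ ⊕ rhs₂` (inclusive, `op = Sum.inl ⊕`) or
`lhs ← rhs₁ unless ⊖ rhs₂` (exclusive, `op = Sum.inr ⊖`). -/
structure Rule : Type where
  lhs : Ident
  op : InclOp ⊕ ExclOp
  rhs₁ : Ident
  rhs₂ : Ident

/-- A specification is a finite list of rules. -/
abbrev Spec : Type := List Rule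

/-! ### Encoding of rules as finite data -/

/-- The eight inclusive operators, numbered. -/
def InclOp.equivFin : InclOp ≃ Fin 8 where
  toFun
    | .before => 0
    | .meet => 1
    | .during => 2
    | .coincide => 3
    | .start => 4
    | .finish => 5
    | .overlap => 6
    | .slice => 7
  invFun
    | 0 => .before
    | 1 => .meet
    | 2 => .during
    | 3 => .coincide
    | 4 => .start
    | 5 => .finish
    | 6 => .overlap
    | 7 => .slice
  left_inv o := by cases o <;> rfl
  right_inv n := by fin_cases n <;> rfl

/-- The three exclusive operators, numbered. -/
def ExclOp.equivFin : ExclOp ≃ Fin 3 where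
  toFun
    | .after => 0
    | .follow => 1
    | .contain => 2
  invFun
    | 0 => .after
    | 1 => .follow
    | 2 => .contain
  left_inv o := by cases o <;> rfl
  right_inv n := by fin_cases n <;> rfl

instance : Primcodable InclOp := Primcodable.ofEquiv (Fin 8) InclOp.equivFin

instance : Primcodable ExclOp := Primcodable.ofEquiv (Fin 3) ExclOp.equivFin

/-- A rule as a tuple of its components. -/
def Rule.equivProd : Rule ≃ Ident × (InclOp ⊕ ExclOp) × Ident × Ident where
  toFun δ := (δ.lhs, δ.op, δ.rhs₁, δ.rhs₂)
  invFun p := ⟨p.1, p.2.1, p.2.2.1, p.2.2.2⟩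
  left_inv _ := rfl
  right_inv _ := rfl

instance : Primcodable Rule :=
  Primcodable.ofEquiv (Ident × (InclOp ⊕ ExclOp) × Ident × Ident) Rule.equivProd

/-! ### Intervals, pools and traces -/

/-- An interval: an identifier with a starting and an ending timestamp. -/
structure Interval : Type where
  id : Ident
  s : ℕ
  e : ℕ
  s_le_e : s ≤ e

/-- A pool is a set of intervals. -/
abbrev Pool : Type := Set Interval

/-- An event: an identifier and a timestamp. -/
abbrev Event : Type := Ident × ℕ

/-- A trace is a finite sequence of events with non-decreasing timestamps. -/
def IsTrace (τ : List Event) : Prop := τ.Pairwise fun a b => a.2 ≤ b.2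

/-- The atomic interval of an event. -/
def initInterval (ev : Event) : Interval := ⟨ev.1, ev.2, ev.2, le_rfl⟩

/-- The pool of the atomic intervals of the events of a trace. -/
def initPool (τ : List Event) : Pool := {i | ∃ ev ∈ τ, i = initInterval ev}

/-! ### Semantics of rules and of lists of rules -/

/-- Clock predicates of inclusive rules: `i` is the produced interval. -/
def InclOp.holds : InclOp → Interval → Interval → Interval → Prop
  | .before, i, i₁, i₂ => i₁.e < i₂.s ∧ i.s = i₁.s ∧ i.e = i₂.e
  | .meet, i, i₁, i₂ => i₁.e = i₂.s ∧ i.s = i₁.s ∧ i.e = i₂.e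
  | .during, i, i₁, i₂ => i₂.s = i.s ∧ i.s ≤ i₁.s ∧ i₁.e ≤ i₂.e ∧ i₂.e = i.e
  | .coincide, i, i₁, i₂ => i₁.s = i₂.s ∧ i₂.s = i.s ∧ i₁.e = i₂.e ∧ i₂.e = i.e
  | .start, i, i₁, i₂ => i₁.s = i₂.s ∧ i₂.s = i.s ∧ i.e = max i₁.e i₂.e
  | .finish, i, i₁, i₂ => i.e = i₁.e ∧ i₁.e = i₂.e ∧ i.s = min i₁.s i₂.s
  | .overlap, i, i₁, i₂ =>
      i₁.s < i₂.e ∧ i₂.s < i₁.e ∧ i.s = min i₁.s i₂.s ∧ i.e = max i₁.e i₂.e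
  | .slice, i, i₁, i₂ =>
      i₁.s < i₂.e ∧ i₂.s < i₁.e ∧ i.s = max i₁.s i₂.s ∧ i.e = min i₁.e i₂.e

/-- Clock predicates of exclusive rules. -/
def ExclOp.holds : ExclOp → Interval → Interval → Prop
  | .after, i₁, i₂ => i₁.s > i₂.e
  | .follow, i₁, i₂ => i₁.s = i₂.e
  | .contain, i₁, i₂ => i₂.s ≥ i₁.s ∧ i₂.e ≤ i₁.e

/-- The semantics `R` of a rule: the set of intervals that it produces from a pool. -/
def ruleSem (δ : Rule) (π : Pool) : Pool :=
  match δ.op with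
  | Sum.inl op =>
      {i | ∃ i₁ ∈ π, ∃ i₂ ∈ π,
        i.id = δ.lhs ∧ i₁.id = δ.rhs₁ ∧ i₂.id = δ.rhs₂ ∧ op.holds i i₁ i₂}
  | Sum.inr op =>
      {i | ∃ i₁ ∈ π, i.id = δ.lhs ∧ i₁.id = δ.rhs₁ ∧ i.s = i₁.s ∧ i.e = i₁.e ∧
        ¬ ∃ i₂ ∈ π, i₂ ≠ i₁ ∧ i₂.id = δ.rhs₂ ∧ op.holds i₁ i₂}

/-- The semantics `S` of a list of rules: the rules are applied once each, in order. -/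
def listSem : List Rule → Pool → Pool
  | [], π => π
  | δ :: D, π => listSem D (π ∪ ruleSem δ π)

/-! ### The dependency graph -/

/-- The edges of the graph `G(D)` on the rules of `D`: from `δ` to `δ'` iff the identifier on the
left-hand side of `δ` appears on the right-hand side of `δ'`. -/
def Edge (D : Spec) (δ δ' : Rule) : Prop :=
  δ ∈ D ∧ δ' ∈ D ∧ (δ.lhs = δ'.rhs₁ ∨ δ.lhs = δ'.rhs₂)

/-- `D` is cycle-free: `G(D)` has no directed cycle (a loop is a cycle). -/
def CycleFree (D : Spec) : Prop := ∀ δ : Rule, ¬ Relation.TransGen (Edge D) δ δ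

/-- Two rules are mutually reachable in `G(D)`. -/
def StronglyConnected (D : Spec) (δ δ' : Rule) : Prop :=
  Relation.ReflTransGen (Edge D) δ δ' ∧ Relation.ReflTransGen (Edge D) δ' δ

/-- The list `C` enumerates, without repetition, a strongly connected component of `G(D)`. -/
def IsComponent (D : Spec) (C : List Rule) : Prop :=
  C.Nodup ∧ ∃ δ ∈ D, ∀ δ' : Rule, δ' ∈ C ↔ δ' ∈ D ∧ StronglyConnected D δ δ'

/-- The list `Cs` enumerates the strongly connected components of `G(D)`, without repetition, in a
topological order: no edge leads from a component to an earlier one. -/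
def IsTopsort (D : Spec) (Cs : List (List Rule)) : Prop :=
  (∀ C ∈ Cs, IsComponent D C) ∧
  (∀ δ ∈ D, ∃ C ∈ Cs, δ ∈ C) ∧
  Cs.Pairwise fun C C' => ∀ δ ∈ C, ∀ δ' ∈ C', δ ≠ δ' ∧ ¬ Edge D δ' δ

/-! ### Semantics of specifications and satisfiability -/

/-- The rules of one component are applied until a fixed point is reached. -/
def componentSem (C : List Rule) (π : Pool) : Pool := ⋃ j : ℕ, (listSem C)^[j] π

/-- The components are evaluated one after the other. -/
def componentsSem : List (List Rule) → Pool → Pool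
  | [], π => π
  | C :: Cs, π => componentsSem Cs (componentSem C π)

/-- The interval `i` is in the pool `T⟦D⟧ τ`: it is produced when the components of `G(D)` are
evaluated in a topological order on the pool of the events of `τ`. -/
def Produces (D : Spec) (τ : List Event) (i : Interval) : Prop :=
  ∃ Cs : List (List Rule), IsTopsort D Cs ∧ i ∈ componentsSem Cs (initPool τ)

/-- `D` is satisfiable for the input identifiers `A` and the target identifier `η`: some non-empty
trace of events with identifiers in `A` makes `D` produce an `η`-labeled interval. -/
def Satisfiable (D : Spec) (A : List Ident) (η : Ident) : Prop :=
  ∃ τ : List Event, τ ≠ [] ∧ IsTrace τ ∧ (∀ ev ∈ τ, ev.1 ∈ A) ∧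
    ∃ i : Interval, i.id = η ∧ Produces D τ i

end Nfer

/-!
In a cycle-free specification no rule uses its own left-hand side, so the fixed point of each
component, a single rule, is reached after one application. The specification is therefore
evaluated by applying each rule once, in an order of the rules in which every rule precedes those
that depend on it (`cycleFree_and_satisfiable_iff`); such an order exists only if the specification
is cycle-free.

Only the order of the timestamps and the identifiers at each of them matter, and each rule is
defined by a first-order condition that quantifies over the endpoints of two intervals. Hence the
pool after `d` rules cannot distinguish positions from which Duplicator wins the
Ehrenfeucht–Fraïssé game with `4 * d` rounds (`poolInvariant_listSem`), and whether an interval with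
the target identifier is produced depends only on the type of rank `4 * d + 2` of the set of events
(`exists_mem_listSem_of_backForth`).

There are finitely many types, and their number `numTypes` is a primitive recursive function of the
input. If a set of events has more timestamps than there are types, then two of its initial segments
have the same type. By the composition lemma `BackForth.union_right`, the events between them can be
deleted without changing the type of the whole set. Together with a renumbering of the timestamps
this gives the small model property `exists_backForth_times_lt`, so that a bounded search decides
the problem (`cycleFree_and_satisfiable_iff_bounded`). The search and the evaluation of the rules on
lists of triples are primitive recursive.
-/

namespace Nfer

/-! ### Back-and-forth equivalence of event sets -/

/-- The timestamps that occur in a set of events. -/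
def times (E : Set Event) : Set ℕ := {t | ∃ η, (η, t) ∈ E}

/-- The pairs of `l` form a partial isomorphism between `E` and `E'`: they match timestamps so that
the order and the identifiers present at a timestamp are preserved. -/
def PartIso (E E' : Set Event) (l : List (ℕ × ℕ)) : Prop :=
  (∀ x ∈ l, ∀ y ∈ l, x.1 < y.1 ↔ x.2 < y.2) ∧
    ∀ x ∈ l, ∀ η, (η, x.1) ∈ E ↔ (η, x.2) ∈ E'

/-- Duplicator wins the Ehrenfeucht–Fraïssé game with `k` rounds on `E` and `E'`, starting from the
position in which the pairs of `l` have been chosen. The players choose timestamps of events. -/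
def BackForth (E E' : Set Event) : ℕ → List (ℕ × ℕ) → Prop
  | 0, l => PartIso E E' l
  | k + 1, l => PartIso E E' l ∧
      (∀ a ∈ times E, ∃ a' ∈ times E', BackForth E E' k ((a, a') :: l)) ∧
      (∀ a' ∈ times E', ∃ a ∈ times E, BackForth E E' k ((a, a') :: l))

theorem PartIso.mono {E E' : Set Event} {l l' : List (ℕ × ℕ)} (h : PartIso E E' l) (hl : l' ⊆ l) :
    PartIso E E' l' :=
  ⟨fun x hx y hy => h.1 x (hl hx) y (hl hy), fun x hx => h.2 x (hl hx)⟩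

theorem PartIso.swap {E E' : Set Event} {l : List (ℕ × ℕ)} (h : PartIso E E' l) :
    PartIso E' E (l.map Prod.swap) := by
  constructor
  · simp only [List.mem_map, forall_exists_index, and_imp]
    rintro _ x hx rfl _ y hy rfl
    exact (h.1 x hx y hy).symm
  · simp only [List.mem_map, forall_exists_index, and_imp]
    rintro _ x hx rfl η
    exact (h.2 x hx η).symm

namespace BackForth

variable {E E' : Set Event} {k : ℕ} {l l' : List (ℕ × ℕ)}

theorem partIso (h : BackForth E E' k l) : PartIso E E' l := by
  cases k with
  | zero => exact h
  | succ k => exact h.1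

theorem mono (h : BackForth E E' k l) (hl : l' ⊆ l) : BackForth E E' k l' := by
  induction k generalizing l l' with
  | zero => exact PartIso.mono h hl
  | succ k ih =>
    refine ⟨h.1.mono hl, fun a ha => ?_, fun a' ha' => ?_⟩
    · obtain ⟨a', ha', h'⟩ := h.2.1 a ha
      exact ⟨a', ha', ih h' (List.cons_subset_cons _ hl)⟩
    · obtain ⟨a, ha, h'⟩ := h.2.2 a' ha'
      exact ⟨a, ha, ih h' (List.cons_subset_cons _ hl)⟩

theorem pred (h : BackForth E E' (k + 1) l) : BackForth E E' k l := by
  induction k generalizing l with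
  | zero => exact h.1
  | succ k ih =>
    refine ⟨h.1, fun a ha => ?_, fun a' ha' => ?_⟩
    · obtain ⟨a', ha', h'⟩ := h.2.1 a ha
      exact ⟨a', ha', ih h'⟩
    · obtain ⟨a, ha, h'⟩ := h.2.2 a' ha'
      exact ⟨a, ha, ih h'⟩

theorem of_le {j : ℕ} (h : BackForth E E' k l) (hj : j ≤ k) : BackForth E E' j l := by
  induction hj with
  | refl => exact h
  | step _ ih => exact ih h.pred

theorem swap (h : BackForth E E' k l) : BackForth E' E k (l.map Prod.swap) := by
  induction k generalizing l with
  | zero => exact PartIso.swap h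
  | succ k ih =>
    refine ⟨h.1.swap, fun a' ha' => ?_, fun a ha => ?_⟩
    · obtain ⟨a, ha, h'⟩ := h.2.2 a' ha'
      exact ⟨a, ha, ih h'⟩
    · obtain ⟨a', ha', h'⟩ := h.2.1 a ha
      exact ⟨a', ha', ih h'⟩

/-- Equivalent left parts may be exchanged in front of the same right part: on the right part,
Duplicator copies the moves of Spoiler. -/
theorem union_right {F F' R : Set Event} {b : ℕ} (hF : ∀ t ∈ times F, t < b)
    (hF' : ∀ t ∈ times F', t < b) (hR : ∀ t ∈ times R, b ≤ t) {r : List ℕ} (hr : ∀ t ∈ r, b ≤ t)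
    (hl : ∀ x ∈ l, x.1 < b ∧ x.2 < b) (h : BackForth F F' k l) :
    BackForth (F ∪ R) (F' ∪ R) k (l ++ r.map fun t => (t, t)) := by
  have iso : ∀ {l : List (ℕ × ℕ)} {r : List ℕ}, (∀ t ∈ r, b ≤ t) →
      (∀ x ∈ l, x.1 < b ∧ x.2 < b) → PartIso F F' l →
      PartIso (F ∪ R) (F' ∪ R) (l ++ r.map fun t => (t, t)) := by
    intro l r hr hl h
    constructor
    · intro x hx y hy
      simp only [List.mem_append, List.mem_map] at hx hy
      rcases hx with hx | ⟨t, ht, rfl⟩ <;> rcases hy with hy | ⟨u, hu, rfl⟩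
      · exact h.1 x hx y hy
      · have := hl x hx; have := hr u hu; simp only; omega
      · have := hl y hy; have := hr t ht; simp only; omega
      · exact Iff.rfl
    · intro x hx η
      simp only [List.mem_append, List.mem_map] at hx
      rcases hx with hx | ⟨t, ht, rfl⟩
      · have h1 : (η, x.1) ∉ R := fun hc => by
          have := hR _ ⟨η, hc⟩; have := hl x hx; omega
        have h2 : (η, x.2) ∉ R := fun hc => by
          have := hR _ ⟨η, hc⟩; have := hl x hx; omega
        simp only [Set.mem_union, h1, h2, or_false]
        exact h.2 x hx η
      · have h1 : (η, t) ∉ F := fun hc => by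
          have := hF _ ⟨η, hc⟩; have := hr t ht; omega
        have h2 : (η, t) ∉ F' := fun hc => by
          have := hF' _ ⟨η, hc⟩; have := hr t ht; omega
        simp only [Set.mem_union, h1, h2, false_or]
  induction k generalizing l r with
  | zero => exact iso hr hl h
  | succ k ih =>
    have right : ∀ a ∈ times R, BackForth (F ∪ R) (F' ∪ R) k
        ((a, a) :: (l ++ r.map fun t => (t, t))) := fun a ha => by
      have hr' : ∀ t ∈ a :: r, b ≤ t := by
        simpa using ⟨hR a ha, hr⟩
      refine (ih hr' hl h.pred).mono ?_
      intro x
      simp only [List.mem_cons, List.mem_append, List.map_cons]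
      tauto
    have left : ∀ a ∈ times F, ∀ a' ∈ times F', BackForth F F' k ((a, a') :: l) →
        BackForth (F ∪ R) (F' ∪ R) k ((a, a') :: (l ++ r.map fun t => (t, t))) :=
      fun a ha a' ha' h' => ih (l := (a, a') :: l) hr
        (by simpa using ⟨⟨hF a ha, hF' a' ha'⟩, fun x y => hl (x, y)⟩) h'
    refine ⟨iso hr hl h.1, ?_, ?_⟩
    · rintro a ⟨η, ha | ha⟩
      · obtain ⟨a', ⟨η', ha'⟩, h'⟩ := h.2.1 a ⟨η, ha⟩
        exact ⟨a', ⟨η', Or.inl ha'⟩, left a ⟨η, ha⟩ a' ⟨η', ha'⟩ h'⟩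
      · exact ⟨a, ⟨η, Or.inr ha⟩, right a ⟨η, ha⟩⟩
    · rintro a' ⟨η', ha' | ha'⟩
      · obtain ⟨a, ⟨η, ha⟩, h'⟩ := h.2.2 a' ⟨η', ha'⟩
        exact ⟨a, ⟨η, Or.inl ha⟩, left a ⟨η, ha⟩ a' ⟨η', ha'⟩ h'⟩
      · exact ⟨a', ⟨η', Or.inr ha'⟩, right a' ⟨η', ha'⟩⟩

/-- Renumbering the timestamps by a strictly monotone function preserves the event set up to
back-and-forth equivalence of every rank. -/
theorem image_of_strictMonoOn {f : ℕ → ℕ} (hf : StrictMonoOn f (times E))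
    (hl : ∀ x ∈ l, x.1 ∈ times E ∧ x.2 = f x.1) :
    BackForth E ((fun ev : Event => (ev.1, f ev.2)) '' E) k l := by
  have iso : ∀ {l : List (ℕ × ℕ)}, (∀ x ∈ l, x.1 ∈ times E ∧ x.2 = f x.1) →
      PartIso E ((fun ev : Event => (ev.1, f ev.2)) '' E) l := by
    intro l hl
    refine ⟨fun x hx y hy => ?_, fun x hx η => ?_⟩
    · rw [(hl x hx).2, (hl y hy).2, hf.lt_iff_lt (hl x hx).1 (hl y hy).1]
    · rw [(hl x hx).2]
      constructor
      · exact fun h => ⟨_, h, rfl⟩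
      · rintro ⟨⟨η', t⟩, ht, he⟩
        simp only [Prod.mk.injEq] at he
        obtain ⟨rfl, he⟩ := he
        rwa [← hf.injOn ⟨_, ht⟩ (hl x hx).1 he]
  induction k generalizing l with
  | zero => exact iso hl
  | succ k ih =>
    have step : ∀ a ∈ times E, BackForth E ((fun ev : Event => (ev.1, f ev.2)) '' E) k
        ((a, f a) :: l) := fun a ha => ih (by simpa using ⟨ha, fun x y => hl (x, y)⟩)
    refine ⟨iso hl, ?_, ?_⟩
    · rintro a ⟨η, ha⟩
      exact ⟨f a, ⟨η, _, ha, rfl⟩, step a ⟨η, ha⟩⟩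
    · rintro _ ⟨η', ⟨η, a⟩, ha, he⟩
      simp only [Prod.mk.injEq] at he
      obtain ⟨rfl, rfl⟩ := he
      exact ⟨a, ⟨_, ha⟩, step a ⟨_, ha⟩⟩

end BackForth

/-! ### Finitely many types, and the small model property -/

/-- The quantifier-free information about at most `K` timestamps in an event set over the
identifiers `A`: the order of the timestamps, and the identifiers at each of them. -/
abbrev AtomType (K : ℕ) (A : List Ident) : Type :=
  Set (Fin K × Fin K) × Set (Fin K × Fin A.length)

/-- The types of rank `k`: the quantifier-free information about the chosen timestamps, with the
set of types of rank `k - 1` that arise by choosing one more timestamp. The bound `K` on the total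
number of timestamps is fixed, so that all ranks share the same quantifier-free types. -/
def RankType (K : ℕ) (A : List Ident) : ℕ → Type
  | 0 => AtomType K A
  | k + 1 => AtomType K A × Set (RankType K A k)

/-- The number of types of rank `k` for `n` identifiers. -/
def numTypes (K n : ℕ) : ℕ → ℕ
  | 0 => 2 ^ (K * K) * 2 ^ (K * n)
  | k + 1 => 2 ^ (K * K) * 2 ^ (K * n) * 2 ^ numTypes K n k

instance (K : ℕ) (A : List Ident) (k : ℕ) : Finite (RankType K A k) := by
  induction k with
  | zero => exact inferInstanceAs (Finite (AtomType K A))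
  | succ k ih => exact inferInstanceAs (Finite (AtomType K A × Set (RankType K A k)))

theorem card_atomType (K : ℕ) (A : List Ident) :
    Nat.card (AtomType K A) = 2 ^ (K * K) * 2 ^ (K * A.length) := by
  simp [AtomType, Nat.card_eq_fintype_card]

theorem card_rankType (K : ℕ) (A : List Ident) (k : ℕ) :
    Nat.card (RankType K A k) = numTypes K A.length k := by
  induction k with
  | zero => exact card_atomType K A
  | succ k ih =>
    have : Nat.card (Set (RankType K A k)) = 2 ^ Nat.card (RankType K A k) := by
      have := Fintype.ofFinite (RankType K A k)
      simp [Nat.card_eq_fintype_card]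
    change Nat.card (AtomType K A × Set (RankType K A k)) = _
    rw [Nat.card_prod, card_atomType, this, ih]
    rfl

/-- The quantifier-free type of the timestamps `p` in `E`. Missing timestamps default to `0`. -/
def atomType (K : ℕ) (A : List Ident) (E : Set Event) (p : List ℕ) : AtomType K A :=
  ({ij | p.getD ij.1 0 < p.getD ij.2 0}, {ij | (A.get ij.2, p.getD ij.1 0) ∈ E})

/-- The type of rank `k` of the timestamps `p` in `E`. -/
def rankType (K : ℕ) (A : List Ident) (E : Set Event) : (k : ℕ) → List ℕ → RankType K A k
  | 0, p => atomType K A E p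
  | k + 1, p => (atomType K A E p, {T | ∃ a ∈ times E, rankType K A E k (a :: p) = T})

theorem partIso_of_atomType_eq {K : ℕ} {A : List Ident} {E E' : Set Event}
    (hE : ∀ ev ∈ E, ev.1 ∈ A) (hE' : ∀ ev ∈ E', ev.1 ∈ A) {l : List (ℕ × ℕ)} (hl : l.length ≤ K)
    (h : atomType K A E (l.map Prod.fst) = atomType K A E' (l.map Prod.snd)) : PartIso E E' l := by
  have fst_eq : ∀ i (hi : i < l.length), (l.map Prod.fst).getD i 0 = l[i].1 := by
    intro i hi; simp [hi]
  have snd_eq : ∀ i (hi : i < l.length), (l.map Prod.snd).getD i 0 = l[i].2 := by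
    intro i hi; simp [hi]
  simp only [atomType, Prod.mk.injEq] at h
  constructor
  · intro x hx y hy
    obtain ⟨i, hi, rfl⟩ := List.getElem_of_mem hx
    obtain ⟨j, hj, rfl⟩ := List.getElem_of_mem hy
    have := Set.ext_iff.1 h.1 (⟨i, by omega⟩, ⟨j, by omega⟩)
    simpa only [Set.mem_ofPred_eq, fst_eq i hi, fst_eq j hj, snd_eq i hi, snd_eq j hj] using this
  · intro x hx η
    obtain ⟨i, hi, rfl⟩ := List.getElem_of_mem hx
    by_cases hη : η ∈ A
    · obtain ⟨j, hj, rfl⟩ := List.getElem_of_mem hη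
      have := Set.ext_iff.1 h.2 (⟨i, by omega⟩, ⟨j, hj⟩)
      simpa only [Set.mem_ofPred_eq, fst_eq i hi, snd_eq i hi, List.get_eq_getElem] using this
    · exact ⟨fun hc => absurd (hE _ hc) hη, fun hc => absurd (hE' _ hc) hη⟩

/-- Equal types are equivalent, as long as the timestamps chosen so far and in the remaining rounds
fit into the bound `K`. -/
theorem backForth_of_rankType_eq {K : ℕ} {A : List Ident} {E E' : Set Event}
    (hE : ∀ ev ∈ E, ev.1 ∈ A) (hE' : ∀ ev ∈ E', ev.1 ∈ A) {k : ℕ} {l : List (ℕ × ℕ)}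
    (hl : l.length + k ≤ K)
    (h : rankType K A E k (l.map Prod.fst) = rankType K A E' k (l.map Prod.snd)) :
    BackForth E E' k l := by
  induction k generalizing l with
  | zero => exact partIso_of_atomType_eq hE hE' hl h
  | succ k ih =>
    have h1 := congrArg Prod.fst h
    have h2 := congrArg Prod.snd h
    simp only [rankType] at h1 h2
    refine ⟨partIso_of_atomType_eq hE hE' (by omega) h1, fun a ha => ?_, fun a' ha' => ?_⟩
    · obtain ⟨a', ha', h'⟩ := (Set.ext_iff.1 h2 _).1 ⟨a, ha, rfl⟩
      exact ⟨a', ha', ih (l := (a, a') :: l) (by simp; omega) h'.symm⟩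
    · obtain ⟨a, ha, h'⟩ := (Set.ext_iff.1 h2 _).2 ⟨a', ha', rfl⟩
      exact ⟨a, ha, ih (l := (a, a') :: l) (by simp; omega) h'⟩

/-- The events of `E` before time `t`. -/
def eventsBefore (E : Set Event) (t : ℕ) : Set Event := {ev ∈ E | ev.2 < t}

theorem lt_of_mem_times_eventsBefore {E : Set Event} {t u : ℕ}
    (h : u ∈ times (eventsBefore E t)) : u < t := by
  obtain ⟨η, h⟩ := h
  exact h.2

/-- An event set with more timestamps than there are types is equivalent to one with fewer
timestamps: two initial segments have the same type, and the events between them are deleted. -/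
theorem exists_backForth_of_numTypes_lt {A : List Ident} {E : Set Event} (hE : ∀ ev ∈ E, ev.1 ∈ A)
    (hfin : (times E).Finite) (k : ℕ) (hcard : numTypes k A.length k < (times E).ncard) :
    ∃ E' ⊆ E, E'.Nonempty ∧ (times E').ncard < (times E).ncard ∧ BackForth E E' k [] := by
  obtain ⟨a, ha, b, hb, hab, heq⟩ :
      ∃ a ∈ times E, ∃ b ∈ times E, a < b ∧
        rankType k A (eventsBefore E a) k [] = rankType k A (eventsBefore E b) k [] := by
    have : Finite (times E) := hfin
    have hlt : Nat.card (RankType k A k) < Nat.card (times E) := by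
      rwa [card_rankType, Nat.card_coe_set_eq]
    obtain ⟨⟨a, ha⟩, ⟨b, hb⟩, hne, heq⟩ : ∃ a b : times E, a ≠ b ∧
        rankType k A (eventsBefore E a) k [] = rankType k A (eventsBefore E b) k [] := by
      by_contra! hc
      exact absurd (Nat.card_le_card_of_injective
        (fun t : times E => rankType k A (eventsBefore E t) k [])
        fun a b hab => by_contra fun hne => hc a b hne hab) (by omega)
    rcases lt_or_gt_of_ne (fun h => hne (Subtype.ext h) : a ≠ b) with h | h
    · exact ⟨a, ha, b, hb, h, heq⟩
    · exact ⟨b, hb, a, ha, h, heq.symm⟩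
  let R : Set Event := {ev ∈ E | b ≤ ev.2}
  have hb_mem : ∃ η, (η, b) ∈ R := by
    obtain ⟨η, h⟩ := hb
    exact ⟨η, h, le_rfl⟩
  have hsub : eventsBefore E a ∪ R ⊆ E := Set.union_subset (fun _ h => h.1) (fun _ h => h.1)
  have hEq : eventsBefore E b ∪ R = E := by
    ext ev
    simp only [eventsBefore, R, Set.mem_union, Set.mem_ofPred_eq, ← and_or_left]
    exact and_iff_left (lt_or_ge _ _)
  refine ⟨eventsBefore E a ∪ R, hsub, ?_, ?_, ?_⟩
  · obtain ⟨η, h⟩ := hb_mem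
    exact ⟨_, Or.inr h⟩
  · refine Set.ncard_lt_ncard ⟨?_, fun hc => ?_⟩ hfin
    · rintro t ⟨η, h⟩
      exact ⟨η, hsub h⟩
    · obtain ⟨η, h | h⟩ := hc ha
      · exact lt_irrefl a h.2
      · have : b ≤ a := h.2
        omega
  · have h := backForth_of_rankType_eq (E := eventsBefore E b) (E' := eventsBefore E a)
      (K := k) (k := k) (l := []) (fun ev h => hE ev h.1) (fun ev h => hE ev h.1) (by simp) heq.symm
    have h' := h.union_right (b := b) (R := R) (r := [])
      (fun t ht => lt_of_mem_times_eventsBefore ht)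
      (fun t ht => (lt_of_mem_times_eventsBefore ht).trans hab)
      (fun t ht => by obtain ⟨η, ht⟩ := ht; exact ht.2) (by simp) (by simp)
    rwa [hEq] at h'

theorem BackForth.trans_nil {E E' E'' : Set Event} {k : ℕ} (h : BackForth E E' k [])
    (h' : BackForth E' E'' k []) : BackForth E E'' k [] := by
  suffices H : ∀ (k : ℕ) (l : List (ℕ × ℕ × ℕ)),
      BackForth E E' k (l.map fun x => (x.1, x.2.1)) →
      BackForth E' E'' k (l.map fun x => (x.2.1, x.2.2)) →
      BackForth E E'' k (l.map fun x => (x.1, x.2.2)) from H k [] h h'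
  have iso : ∀ l : List (ℕ × ℕ × ℕ),
      PartIso E E' (l.map fun x => (x.1, x.2.1)) →
      PartIso E' E'' (l.map fun x => (x.2.1, x.2.2)) →
      PartIso E E'' (l.map fun x => (x.1, x.2.2)) := by
    intro l h h'
    simp only [PartIso, List.forall_mem_map] at h h' ⊢
    exact ⟨fun x hx y hy => (h.1 x hx y hy).trans (h'.1 x hx y hy),
      fun x hx η => (h.2 x hx η).trans (h'.2 x hx η)⟩
  intro k
  induction k with
  | zero => exact iso
  | succ k ih =>
    intro l h h'
    refine ⟨iso l h.1 h'.1, fun a ha => ?_, fun c hc => ?_⟩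
    · obtain ⟨b, hb, h1⟩ := h.2.1 a ha
      obtain ⟨c, hc, h2⟩ := h'.2.1 b hb
      exact ⟨c, hc, ih ((a, b, c) :: l) h1 h2⟩
    · obtain ⟨b, hb, h2⟩ := h'.2.2 c hc
      obtain ⟨a, ha, h1⟩ := h.2.2 b hb
      exact ⟨a, ha, ih ((a, b, c) :: l) h1 h2⟩

/-- Small model property: a non-empty finite event set over `A` is equivalent up to rank `k` to one
whose timestamps are less than the number of types. -/
theorem exists_backForth_times_lt {A : List Ident} {E : Set Event} (hE : ∀ ev ∈ E, ev.1 ∈ A)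
    (hfin : (times E).Finite) (hne : E.Nonempty) (k : ℕ) :
    ∃ E' : Set Event, E'.Nonempty ∧ (∀ ev ∈ E', ev.1 ∈ A ∧ ev.2 < numTypes k A.length k) ∧
      BackForth E E' k [] := by
  induction hn : (times E).ncard using Nat.strong_induction_on generalizing E with
  | _ n ih =>
  by_cases hcard : numTypes k A.length k < (times E).ncard
  · obtain ⟨E', hsub, hne', hlt, hbf⟩ := exists_backForth_of_numTypes_lt hE hfin k hcard
    obtain ⟨E'', h1, h2, h3⟩ := ih _ (hn ▸ hlt) (fun ev h => hE ev (hsub h))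
      (hfin.subset fun t ⟨η, h⟩ => ⟨η, hsub h⟩) hne' rfl
    exact ⟨E'', h1, h2, hbf.trans_nil h3⟩
  · -- The timestamps are replaced by their positions in increasing order.
    let f : ℕ → ℕ := fun t => (times E ∩ Set.Iio t).ncard
    have hsub : ∀ t u, t ∈ times E → t < u → f t < f u := fun t u ht htu =>
      Set.ncard_lt_ncard ⟨fun x hx => ⟨hx.1, lt_trans hx.2 htu⟩, fun hc =>
        lt_irrefl t (hc ⟨ht, htu⟩).2⟩ (hfin.inter_of_left _)
    refine ⟨_, hne.image _, ?_, BackForth.image_of_strictMonoOn (f := f)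
      (fun t ht u _ htu => hsub t u ht htu) (by simp)⟩
    rintro _ ⟨⟨η, t⟩, h, rfl⟩
    refine ⟨hE (η, t) h, lt_of_lt_of_le ?_ (not_lt.1 hcard)⟩
    exact Set.ncard_lt_ncard ⟨fun x hx => hx.1, fun hc => lt_irrefl t (hc ⟨η, h⟩).2⟩ hfin

/-! ### Evaluation of cycle-free specifications -/

/-- The rule `δ'` uses the identifier defined by the rule `δ`. -/
def Feeds (δ δ' : Rule) : Prop := δ.lhs = δ'.rhs₁ ∨ δ.lhs = δ'.rhs₂

/-- The list `L` enumerates the rules of `D` without repetition so that every rule precedes the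
rules that use its left-hand side. -/
def IsRuleOrder (D : Spec) (L : List Rule) : Prop :=
  ((∀ δ ∈ L, δ ∈ D) ∧ ∀ δ ∈ D, δ ∈ L) ∧
  L.Pairwise (fun δ δ' => δ ≠ δ' ∧ ¬ Feeds δ' δ) ∧ ∀ δ ∈ L, ¬ Feeds δ δ

theorem IsRuleOrder.cycleFree {D : Spec} {L : List Rule} (h : IsRuleOrder D L) : CycleFree D := by
  classical
  have mono : ∀ δ δ', Edge D δ δ' → L.idxOf δ < L.idxOf δ' := by
    rintro δ δ' ⟨hδ, hδ', hf⟩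
    have h1 := List.idxOf_lt_length_of_mem (h.1.2 δ hδ)
    have h2 := List.idxOf_lt_length_of_mem (h.1.2 δ' hδ')
    rcases lt_trichotomy (L.idxOf δ) (L.idxOf δ') with hlt | heq | hgt
    · exact hlt
    · rw [List.idxOf_inj (h.1.2 δ hδ)] at heq
      subst heq
      exact absurd hf (h.2.2 δ (h.1.2 δ hδ))
    · have := List.pairwise_iff_getElem.1 h.2.1 _ _ h2 h1 hgt
      simp only [List.getElem_idxOf] at this
      exact absurd hf this.2
  intro δ hδ
  have : ∀ δ', Relation.TransGen (Edge D) δ δ' → L.idxOf δ < L.idxOf δ' := by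
    intro δ' h
    induction h with
    | single h => exact mono _ _ h
    | tail _ h ih => exact ih.trans (mono _ _ h)
  exact lt_irrefl _ (this δ hδ)

theorem IsRuleOrder.nodup {D : Spec} {L : List Rule} (h : IsRuleOrder D L) : L.Nodup :=
  h.2.1.imp fun h => h.1

theorem isTopsort_map_singleton {D : Spec} {L : List Rule} (h : IsRuleOrder D L) :
    IsTopsort D (L.map fun δ => [δ]) := by
  refine ⟨?_, fun δ hδ => ⟨[δ], List.mem_map.2 ⟨δ, h.1.2 δ hδ, rfl⟩, by simp⟩, ?_⟩
  · simp only [List.forall_mem_map]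
    refine fun δ hδ => ⟨by simp, δ, h.1.1 δ hδ, fun δ' => ?_⟩
    rw [List.mem_singleton]
    constructor
    · rintro rfl
      exact ⟨h.1.1 _ hδ, .refl, .refl⟩
    · rintro ⟨-, h1, h2⟩
      by_contra hne
      rcases Relation.reflTransGen_iff_eq_or_transGen.1 h1 with he | h1
      · exact hne he
      · exact h.cycleFree δ (h1.trans_left h2)
  · rw [List.pairwise_map]
    refine h.2.1.imp fun {δ δ'} hd => ?_
    simp only [List.mem_singleton, forall_eq]
    exact ⟨hd.1, fun he => hd.2 he.2.2⟩

theorem exists_isRuleOrder_of_isTopsort {D : Spec} (hD : CycleFree D) {Cs : List (List Rule)}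
    (hCs : IsTopsort D Cs) : ∃ L, IsRuleOrder D L ∧ Cs = L.map fun δ => [δ] := by
  have single : ∀ C ∈ Cs, ∃ δ ∈ D, C = [δ] := by
    intro C hC
    obtain ⟨hnd, δ, hδ, hmem⟩ := hCs.1 C hC
    refine ⟨δ, hδ, ?_⟩
    have h1 : ∀ δ' ∈ C, δ' = δ := by
      intro δ' h'
      obtain ⟨-, h1, h2⟩ := (hmem δ').1 h'
      rcases Relation.reflTransGen_iff_eq_or_transGen.1 h1 with he | h1
      · exact he
      · exact absurd (h1.trans_left h2) (hD δ)
    have h2 : δ ∈ C := (hmem δ).2 ⟨hδ, .refl, .refl⟩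
    rw [← List.perm_singleton]
    exact (List.perm_ext_iff_of_nodup hnd (List.nodup_singleton δ)).2 fun δ' =>
      ⟨fun h => List.mem_singleton.2 (h1 δ' h), fun h => List.mem_singleton.1 h ▸ h2⟩
  have : ∃ L : List Rule, Cs = L.map fun δ => [δ] := by
    have hs : ∀ C ∈ Cs, ∃ δ, C = [δ] := fun C hC => by
      obtain ⟨δ, -, h⟩ := single C hC
      exact ⟨δ, h⟩
    clear single hCs
    induction Cs with
    | nil => exact ⟨[], rfl⟩
    | cons C Cs ih =>
      obtain ⟨L, hL⟩ := ih fun C' h => hs C' (List.mem_cons_of_mem _ h)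
      obtain ⟨δ, hδ⟩ := hs C List.mem_cons_self
      exact ⟨δ :: L, by simp [hL, hδ]⟩
  obtain ⟨L, rfl⟩ := this
  have memD : ∀ δ ∈ L, δ ∈ D := fun δ hδ => by
    obtain ⟨δ', h, he⟩ := single [δ] (List.mem_map.2 ⟨δ, hδ, rfl⟩)
    simp only [List.cons.injEq, and_true] at he
    exact he ▸ h
  refine ⟨L, ⟨⟨memD, fun δ hδ => ?_⟩, ?_, fun δ hδ hf => ?_⟩, rfl⟩
  · obtain ⟨C, hC, h⟩ := hCs.2.1 δ hδ
    obtain ⟨δ', h', rfl⟩ := List.mem_map.1 hC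
    rwa [List.mem_singleton.1 h]
  · have h := hCs.2.2
    rw [List.pairwise_map] at h
    refine h.imp_of_mem fun {δ δ'} hδ hδ' hd => ?_
    simp only [List.mem_singleton, forall_eq] at hd
    exact ⟨hd.1, fun he => hd.2 ⟨memD _ hδ', memD _ hδ, he⟩⟩
  · exact hD δ (.single ⟨memD δ hδ, memD δ hδ, hf⟩)

/-- A rule that does not use its own left-hand side produces nothing new when it is repeated. -/
theorem ruleSem_union_ruleSem {δ : Rule} (hδ : ¬ Feeds δ δ) (π : Pool) :
    ruleSem δ (π ∪ ruleSem δ π) = ruleSem δ π := by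
  have hid : ∀ i ∈ ruleSem δ π, i.id = δ.lhs := by
    intro i hi
    unfold ruleSem at hi
    split at hi
    · obtain ⟨_, _, _, _, h, _⟩ := hi
      exact h
    · obtain ⟨_, _, h, _⟩ := hi
      exact h
  have h1 : ∀ i, i.id = δ.rhs₁ → (i ∈ π ∪ ruleSem δ π ↔ i ∈ π) := fun i h =>
    or_iff_left fun hc => hδ (Or.inl ((hid i hc).symm.trans h))
  have h2 : ∀ i, i.id = δ.rhs₂ → (i ∈ π ∪ ruleSem δ π ↔ i ∈ π) := fun i h =>
    or_iff_left fun hc => hδ (Or.inr ((hid i hc).symm.trans h))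
  generalize π ∪ ruleSem δ π = ρ at h1 h2
  unfold ruleSem
  split
  · ext i
    constructor
    · rintro ⟨i₁, hi₁, i₂, hi₂, h, e1, e2, ho⟩
      exact ⟨i₁, (h1 _ e1).1 hi₁, i₂, (h2 _ e2).1 hi₂, h, e1, e2, ho⟩
    · rintro ⟨i₁, hi₁, i₂, hi₂, h, e1, e2, ho⟩
      exact ⟨i₁, (h1 _ e1).2 hi₁, i₂, (h2 _ e2).2 hi₂, h, e1, e2, ho⟩
  · ext i
    constructor
    · rintro ⟨i₁, hi₁, h, e1, hs, he, hn⟩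
      exact ⟨i₁, (h1 _ e1).1 hi₁, h, e1, hs, he,
        fun ⟨i₂, hi₂, hne, e2, ho⟩ => hn ⟨i₂, (h2 _ e2).2 hi₂, hne, e2, ho⟩⟩
    · rintro ⟨i₁, hi₁, h, e1, hs, he, hn⟩
      exact ⟨i₁, (h1 _ e1).2 hi₁, h, e1, hs, he,
        fun ⟨i₂, hi₂, hne, e2, ho⟩ => hn ⟨i₂, (h2 _ e2).1 hi₂, hne, e2, ho⟩⟩

theorem componentSem_singleton {δ : Rule} (hδ : ¬ Feeds δ δ) (π : Pool) :
    componentSem [δ] π = π ∪ ruleSem δ π := by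
  have hfix : ∀ j, (listSem [δ])^[j] (π ∪ ruleSem δ π) = π ∪ ruleSem δ π := by
    intro j
    refine Function.iterate_fixed ?_ j
    simp only [listSem, ruleSem_union_ruleSem hδ, Set.union_assoc, Set.union_self]
  apply Set.Subset.antisymm
  · refine Set.iUnion_subset fun j => ?_
    cases j with
    | zero => exact Set.subset_union_left
    | succ j =>
      rw [Function.iterate_succ_apply]
      exact (hfix j).subset
  · exact Set.subset_iUnion_of_subset 1 (by simp [listSem])

theorem componentsSem_map_singleton {L : List Rule} (hL : ∀ δ ∈ L, ¬ Feeds δ δ) (π : Pool) :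
    componentsSem (L.map fun δ => [δ]) π = listSem L π := by
  induction L generalizing π with
  | nil => rfl
  | cons δ L ih =>
    simp only [List.map_cons, componentsSem, listSem]
    rw [componentSem_singleton (hL δ List.mem_cons_self),
      ih fun δ' h => hL δ' (List.mem_cons_of_mem _ h)]

/-- The pool of the atomic intervals of a set of events. -/
def eventPool (E : Set Event) : Pool := {i | ∃ ev ∈ E, i = initInterval ev}

/-- In a cycle-free specification every rule is applied once, in an order that respects the
dependencies. The order of the events is immaterial. -/
theorem cycleFree_and_satisfiable_iff (D : Spec) (A : List Ident) (η : Ident) :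
    CycleFree D ∧ Satisfiable D A η ↔
      ∃ L, IsRuleOrder D L ∧ ∃ τ : List Event, τ ≠ [] ∧ (∀ ev ∈ τ, ev.1 ∈ A) ∧
        ∃ i ∈ listSem L (eventPool {ev | ev ∈ τ}), i.id = η := by
  constructor
  · rintro ⟨hD, τ, hne, -, hA, i, hi, Cs, hCs, hmem⟩
    obtain ⟨L, hL, rfl⟩ := exists_isRuleOrder_of_isTopsort hD hCs
    rw [componentsSem_map_singleton hL.2.2] at hmem
    exact ⟨L, hL, τ, hne, hA, i, hmem, hi⟩
  · rintro ⟨L, hL, τ, hne, hA, i, hmem, hi⟩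
    refine ⟨hL.cycleFree, ?_⟩
    let σ := τ.mergeSort fun a b => a.2 ≤ b.2
    have hperm : ∀ ev, ev ∈ σ ↔ ev ∈ τ := fun ev => (List.mergeSort_perm τ _).mem_iff
    have hpool : initPool σ = eventPool {ev | ev ∈ τ} := by
      ext i
      simp only [initPool, eventPool, hperm, Set.mem_ofPred_eq]
    refine ⟨σ, fun hc => hne ?_, ?_, fun ev h => hA ev ((hperm ev).1 h), i, hi,
      _, isTopsort_map_singleton hL, ?_⟩
    · exact (hc ▸ (List.mergeSort_perm τ _).symm : τ.Perm []).eq_nil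
    · have := List.pairwise_mergeSort (le := fun a b : Event => decide (a.2 ≤ b.2))
        (fun a b c => by simpa using le_trans) (fun a b => by simpa using le_total a.2 b.2) τ
      simpa [IsTrace, σ] using this
    · rwa [componentsSem_map_singleton hL.2.2, hpool]

/-! ### Invariance of the pools under back-and-forth equivalence -/

/-- All endpoints of intervals of `π` lie in `T`. With `T` the timestamps of the events, endpoints
are legal moves of the game. -/
def EndpointsIn (T : Set ℕ) (π : Pool) : Prop := ∀ i ∈ π, i.s ∈ T ∧ i.e ∈ T

theorem max_mem_of {T : Set ℕ} {a b : ℕ} (ha : a ∈ T) (hb : b ∈ T) : max a b ∈ T := by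
  rcases max_choice a b with h | h <;> rw [h] <;> assumption

theorem min_mem_of {T : Set ℕ} {a b : ℕ} (ha : a ∈ T) (hb : b ∈ T) : min a b ∈ T := by
  rcases min_choice a b with h | h <;> rw [h] <;> assumption

theorem EndpointsIn.union_ruleSem {T : Set ℕ} {π : Pool} (h : EndpointsIn T π) (δ : Rule) :
    EndpointsIn T (π ∪ ruleSem δ π) := by
  rintro i (hi | hi)
  · exact h i hi
  unfold ruleSem at hi
  split at hi
  · rename_i op _
    obtain ⟨i₁, h₁, i₂, h₂, -, -, -, ho⟩ := hi
    have h₁ := h i₁ h₁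
    have h₂ := h i₂ h₂
    cases op <;> simp only [InclOp.holds] at ho
    · rw [ho.2.1, ho.2.2]; exact ⟨h₁.1, h₂.2⟩
    · rw [ho.2.1, ho.2.2]; exact ⟨h₁.1, h₂.2⟩
    · rw [← ho.1, ← ho.2.2.2]; exact h₂
    · rw [← ho.2.1, ← ho.2.2.2]; exact h₂
    · rw [← ho.2.1, ho.2.2]; exact ⟨h₂.1, max_mem_of h₁.2 h₂.2⟩
    · rw [ho.1, ho.2.2]; exact ⟨min_mem_of h₁.1 h₂.1, h₁.2⟩
    · rw [ho.2.2.1, ho.2.2.2]; exact ⟨min_mem_of h₁.1 h₂.1, max_mem_of h₁.2 h₂.2⟩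
    · rw [ho.2.2.1, ho.2.2.2]; exact ⟨max_mem_of h₁.1 h₂.1, min_mem_of h₁.2 h₂.2⟩
  · obtain ⟨i₁, h₁, -, -, hs, he, -⟩ := hi
    rw [hs, he]
    exact h i₁ h₁

/-- The intervals `i` and `i'` have the same identifier and endpoints matched by `l`. -/
def Matched (l : List (ℕ × ℕ)) (i i' : Interval) : Prop :=
  i.id = i'.id ∧ (i.s, i'.s) ∈ l ∧ (i.e, i'.e) ∈ l

/-- Membership in the pools `π` and `π'` is preserved by positions from which Duplicator wins `k`
rounds. -/
def PoolInvariant (E E' : Set Event) (k : ℕ) (π π' : Pool) : Prop :=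
  ∀ l, BackForth E E' k l → ∀ i i', Matched l i i' → (i ∈ π ↔ i' ∈ π')

theorem Matched.mono {l l' : List (ℕ × ℕ)} {i i' : Interval} (h : Matched l i i') (hl : l ⊆ l') :
    Matched l' i i' := ⟨h.1, hl h.2.1, hl h.2.2⟩

theorem Matched.swap {l : List (ℕ × ℕ)} {i i' : Interval} (h : Matched l i i') :
    Matched (l.map Prod.swap) i' i :=
  ⟨h.1.symm, List.mem_map.2 ⟨_, h.2.1, rfl⟩, List.mem_map.2 ⟨_, h.2.2, rfl⟩⟩

theorem PoolInvariant.swap {E E' : Set Event} {k : ℕ} {π π' : Pool}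
    (h : PoolInvariant E E' k π π') : PoolInvariant E' E k π' π :=
  fun _ hl i i' hi => (h _ hl.swap i' i hi.swap).symm

/-- With two rounds left, Duplicator can answer an interval by a matching interval. -/
theorem BackForth.exists_matched {E E' : Set Event} {k : ℕ} {l : List (ℕ × ℕ)}
    (h : BackForth E E' (k + 2) l) (i : Interval) (hs : i.s ∈ times E) (he : i.e ∈ times E) :
    ∃ l' i', l ⊆ l' ∧ BackForth E E' k l' ∧ Matched l' i i' := by
  obtain ⟨s', -, h1⟩ := h.2.1 _ hs
  obtain ⟨e', -, h2⟩ := h1.2.1 _ he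
  have hle : s' ≤ e' := by
    have := h2.partIso.1 (i.e, e') (by simp) (i.s, s') (by simp)
    have := i.s_le_e
    simp only at *
    omega
  exact ⟨_, ⟨i.id, s', e', hle⟩, fun x hx => by simp [hx], h2, rfl, by simp, by simp⟩

theorem InclOp.holds_of_partIso {E E' : Set Event} {l : List (ℕ × ℕ)} (hl : PartIso E E' l)
    {op : InclOp} {i i' i₁ i₁' i₂ i₂' : Interval} (hi : Matched l i i') (h₁ : Matched l i₁ i₁')
    (h₂ : Matched l i₂ i₂') (h : op.holds i i₁ i₂) : op.holds i' i₁' i₂' := by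
  have lt_iff : ∀ {a a' b b' : ℕ}, (a, a') ∈ l → (b, b') ∈ l → (a < b ↔ a' < b') :=
    fun ha hb => hl.1 _ ha _ hb
  have le : ∀ {a a' b b' : ℕ}, (a, a') ∈ l → (b, b') ∈ l → a ≤ b → a' ≤ b' := fun ha hb h =>
    not_lt.1 fun hc => not_lt.2 h ((lt_iff hb ha).2 hc)
  have eq : ∀ {a a' b b' : ℕ}, (a, a') ∈ l → (b, b') ∈ l → a = b → a' = b' := fun ha hb h =>
    le_antisymm (le ha hb h.le) (le hb ha h.ge)
  have max_eq : ∀ {a a' b b' c c' : ℕ}, (a, a') ∈ l → (b, b') ∈ l → (c, c') ∈ l →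
      a = max b c → a' = max b' c' := by
    intro a a' b b' c c' ha hb hc h
    have := @le b b' a a' hb ha; have := @le c c' a a' hc ha
    have := @eq a a' b b' ha hb; have := @eq a a' c c' ha hc
    omega
  have min_eq : ∀ {a a' b b' c c' : ℕ}, (a, a') ∈ l → (b, b') ∈ l → (c, c') ∈ l →
      a = min b c → a' = min b' c' := by
    intro a a' b b' c c' ha hb hc h
    have := @le a a' b b' ha hb; have := @le a a' c c' ha hc
    have := @eq a a' b b' ha hb; have := @eq a a' c c' ha hc
    omega
  obtain ⟨-, s, e⟩ := hi
  obtain ⟨-, s₁, e₁⟩ := h₁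
  obtain ⟨-, s₂, e₂⟩ := h₂
  cases op
  · exact ⟨(lt_iff e₁ s₂).1 h.1, eq s s₁ h.2.1, eq e e₂ h.2.2⟩
  · exact ⟨eq e₁ s₂ h.1, eq s s₁ h.2.1, eq e e₂ h.2.2⟩
  · exact ⟨eq s₂ s h.1, le s s₁ h.2.1, le e₁ e₂ h.2.2.1, eq e₂ e h.2.2.2⟩
  · exact ⟨eq s₁ s₂ h.1, eq s₂ s h.2.1, eq e₁ e₂ h.2.2.1, eq e₂ e h.2.2.2⟩
  · exact ⟨eq s₁ s₂ h.1, eq s₂ s h.2.1, max_eq e e₁ e₂ h.2.2⟩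
  · exact ⟨eq e e₁ h.1, eq e₁ e₂ h.2.1, min_eq s s₁ s₂ h.2.2⟩
  · exact ⟨(lt_iff s₁ e₂).1 h.1, (lt_iff s₂ e₁).1 h.2.1, min_eq s s₁ s₂ h.2.2.1,
      max_eq e e₁ e₂ h.2.2.2⟩
  · exact ⟨(lt_iff s₁ e₂).1 h.1, (lt_iff s₂ e₁).1 h.2.1, max_eq s s₁ s₂ h.2.2.1,
      min_eq e e₁ e₂ h.2.2.2⟩

theorem ExclOp.holds_of_partIso {E E' : Set Event} {l : List (ℕ × ℕ)} (hl : PartIso E E' l)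
    {op : ExclOp} {i₁ i₁' i₂ i₂' : Interval} (h₁ : Matched l i₁ i₁')
    (h₂ : Matched l i₂ i₂') (h : op.holds i₁ i₂) : op.holds i₁' i₂' := by
  obtain ⟨-, s₁, e₁⟩ := h₁
  obtain ⟨-, s₂, e₂⟩ := h₂
  have a := hl.1 _ s₂ _ s₁
  have b := hl.1 _ e₁ _ e₂
  have c := hl.1 _ s₁ _ e₂
  have d := hl.1 _ e₂ _ s₁
  cases op <;> simp only [ExclOp.holds] at * <;> omega

theorem Matched.eq_of_eq {E E' : Set Event} {l : List (ℕ × ℕ)} (hl : PartIso E E' l)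
    {i i' j j' : Interval} (hi : Matched l i i') (hj : Matched l j j') (h : i = j) : i' = j' := by
  subst h
  obtain ⟨hid, s, e⟩ := hi
  obtain ⟨hjd, s', e'⟩ := hj
  have a := hl.1 _ s _ s'
  have b := hl.1 _ s' _ s
  have c := hl.1 _ e _ e'
  have d := hl.1 _ e' _ e
  obtain ⟨id₁, s₁, e₁, _⟩ := i'
  obtain ⟨id₂, s₂, e₂, _⟩ := j'
  simp only at a b c d hid hjd
  simp only [Interval.mk.injEq]
  exact ⟨hid.symm.trans hjd, by omega, by omega⟩

/-- One half of the invariance step: applying a rule costs at most four rounds, which Duplicator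
spends on the endpoints of the two intervals that the rule combines. -/
theorem PoolInvariant.ruleSem_imp {E E' : Set Event} {k : ℕ} {π π' : Pool}
    (hπ : EndpointsIn (times E) π) (hπ' : EndpointsIn (times E') π')
    (h : PoolInvariant E E' k π π') (δ : Rule) {l : List (ℕ × ℕ)} (hl : BackForth E E' (k + 4) l)
    {i i' : Interval} (hi : Matched l i i') (hmem : i ∈ ruleSem δ π) : i' ∈ ruleSem δ π' := by
  unfold ruleSem at hmem ⊢
  split at hmem
  · obtain ⟨i₁, h₁, i₂, h₂, hid, hid₁, hid₂, ho⟩ := hmem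
    obtain ⟨l₁, i₁', hl₁, hbf₁, hm₁⟩ := hl.exists_matched (k := k + 2) i₁ (hπ _ h₁).1 (hπ _ h₁).2
    obtain ⟨l₂, i₂', hl₂, hbf₂, hm₂⟩ := hbf₁.exists_matched i₂ (hπ _ h₂).1 (hπ _ h₂).2
    have hm₁ := hm₁.mono hl₂
    have hm := hi.mono (List.Subset.trans hl₁ hl₂)
    exact ⟨i₁', (h _ hbf₂ _ _ hm₁).1 h₁, i₂', (h _ hbf₂ _ _ hm₂).1 h₂, hm.1 ▸ hid, hm₁.1 ▸ hid₁,
      hm₂.1 ▸ hid₂, InclOp.holds_of_partIso hbf₂.partIso hm hm₁ hm₂ ho⟩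
  · obtain ⟨i₁, h₁, hid, hid₁, hs, he, hn⟩ := hmem
    obtain ⟨l₁, i₁', hl₁, hbf₁, hm₁⟩ := hl.exists_matched (k := k + 2) i₁ (hπ _ h₁).1 (hπ _ h₁).2
    have hm := hi.mono hl₁
    -- Both intervals have the same endpoints, so their partners do, too.
    have hends : i'.s = i₁'.s ∧ i'.e = i₁'.e := by
      have a := hbf₁.partIso.1 _ hm.2.1 _ hm₁.2.1
      have b := hbf₁.partIso.1 _ hm₁.2.1 _ hm.2.1
      have c := hbf₁.partIso.1 _ hm.2.2 _ hm₁.2.2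
      have d := hbf₁.partIso.1 _ hm₁.2.2 _ hm.2.2
      simp only at a b c d
      omega
    refine ⟨i₁', (h _ (hbf₁.of_le (by omega)) _ _ hm₁).1 h₁, hm.1 ▸ hid, hm₁.1 ▸ hid₁,
      hends.1, hends.2, ?_⟩
    rintro ⟨i₂', h₂', hne, hid₂, ho⟩
    -- A blocking interval of `π'` is transferred back to `π` by a move in the opposite direction.
    obtain ⟨l₂, i₂, hl₂, hbf₂, hm₂⟩ := hbf₁.swap.exists_matched i₂' (hπ' _ h₂').1 (hπ' _ h₂').2
    have hm₁ := hm₁.swap.mono hl₂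
    exact hn ⟨i₂, (h.swap _ hbf₂ _ _ hm₂).1 h₂',
      fun hc => hne (Matched.eq_of_eq hbf₂.swap.partIso hm₂.swap hm₁.swap hc), hm₂.1 ▸ hid₂,
      ExclOp.holds_of_partIso hbf₂.partIso hm₁ hm₂ ho⟩

theorem PoolInvariant.union_ruleSem {E E' : Set Event} {k : ℕ} {π π' : Pool}
    (hπ : EndpointsIn (times E) π) (hπ' : EndpointsIn (times E') π')
    (h : PoolInvariant E E' k π π') (δ : Rule) :
    PoolInvariant E E' (k + 4) (π ∪ ruleSem δ π) (π' ∪ ruleSem δ π') :=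
  fun l hl i i' hi => or_congr (h l (hl.of_le (by omega)) i i' hi)
    ⟨h.ruleSem_imp hπ hπ' δ hl hi, h.swap.ruleSem_imp hπ' hπ δ hl.swap hi.swap⟩

theorem poolInvariant_listSem {E E' : Set Event} (L : List Rule) {k : ℕ} {π π' : Pool}
    (hπ : EndpointsIn (times E) π) (hπ' : EndpointsIn (times E') π')
    (h : PoolInvariant E E' k π π') :
    EndpointsIn (times E) (listSem L π) ∧
      PoolInvariant E E' (k + 4 * L.length) (listSem L π) (listSem L π') := by
  induction L generalizing k π π' with
  | nil => exact ⟨hπ, h⟩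
  | cons δ L ih =>
    have := ih (hπ.union_ruleSem δ) (hπ'.union_ruleSem δ) (h.union_ruleSem hπ hπ' δ)
    refine ⟨this.1, ?_⟩
    rw [List.length_cons, show k + 4 * (L.length + 1) = k + 4 + 4 * L.length by ring]
    exact this.2

theorem endpointsIn_eventPool (E : Set Event) : EndpointsIn (times E) (eventPool E) := by
  rintro _ ⟨⟨η, t⟩, h, rfl⟩
  exact ⟨⟨η, h⟩, ⟨η, h⟩⟩

theorem poolInvariant_eventPool (E E' : Set Event) :
    PoolInvariant E E' 0 (eventPool E) (eventPool E') := by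
  suffices H : ∀ (E E' : Set Event) l, PartIso E E' l → ∀ i i', Matched l i i' →
      i ∈ eventPool E → i' ∈ eventPool E' from
    fun l hl i i' hi => ⟨H E E' l hl i i' hi, H E' E _ hl.swap i' i hi.swap⟩
  rintro E E' l hl _ ⟨η', s', e', hle⟩ ⟨hid, hs, he⟩ ⟨⟨η, t⟩, h, rfl⟩
  simp only [initInterval] at hid hs he
  subst hid
  have a := hl.1 _ hs _ he
  have b := hl.1 _ he _ hs
  have : s' = e' := by simp only at a b; omega
  subst this
  exact ⟨_, (hl.2 _ hs η).1 h, rfl⟩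

/-- Whether an interval with a given identifier is produced depends only on the type of the events
of rank `4 * L.length + 2`: two further rounds are spent on the endpoints of the interval. -/
theorem exists_mem_listSem_of_backForth {E E' : Set Event} {L : List Rule} {k : ℕ}
    (hk : 4 * L.length + 2 ≤ k) (h : BackForth E E' k []) {η : Ident}
    (hi : ∃ i ∈ listSem L (eventPool E), i.id = η) :
    ∃ i ∈ listSem L (eventPool E'), i.id = η := by
  obtain ⟨i, hmem, rfl⟩ := hi
  obtain ⟨hends, hinv⟩ := poolInvariant_listSem L (endpointsIn_eventPool E)
    (endpointsIn_eventPool E') (poolInvariant_eventPool E E')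
  obtain ⟨l, i', -, hl, hm⟩ := (h.of_le hk).exists_matched i (hends i hmem).1 (hends i hmem).2
  rw [Nat.zero_add] at hinv
  exact ⟨i', (hinv l hl i i' hm).1 hmem, hm.1.symm⟩

/-! ### Primitive recursive evaluation -/

/-- All lists of length at most `n` with entries in `l`. -/
def listsOver {β : Type*} (l : List β) : ℕ → List (List β)
  | 0 => [[]]
  | n + 1 => [] :: l.flatMap fun b => (listsOver l n).map (b :: ·)

theorem mem_listsOver {β : Type*} {l m : List β} {n : ℕ} :
    m ∈ listsOver l n ↔ m.length ≤ n ∧ ∀ b ∈ m, b ∈ l := by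
  induction n generalizing m with
  | zero => cases m <;> simp [listsOver]
  | succ n ih => cases m <;> simp [listsOver, ih]; tauto

section Primrec

variable {α β : Type*} [Primcodable α] [Primcodable β]

theorem primrecPred_exists_mem {f : α → List β} {p : α → β → Prop} (hf : Primrec f)
    (hp : PrimrecRel p) : PrimrecPred fun a => ∃ b ∈ f a, p a b :=
  (PrimrecRel.exists_mem_list hp.swap).comp hf .id

theorem primrecPred_forall_mem {f : α → List β} {p : α → β → Prop} (hf : Primrec f)
    (hp : PrimrecRel p) : PrimrecPred fun a => ∀ b ∈ f a, p a b :=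
  (PrimrecRel.forall_mem_list hp.swap).comp hf .id

theorem primrecRel_mem : PrimrecRel fun (b : β) (l : List β) => b ∈ l := by
  have eq : PrimrecRel fun (x : β × List β) (b : β) => b = x.1 :=
    Primrec.eq.comp .snd (Primrec.fst.comp .fst)
  exact (primrecPred_exists_mem .snd eq).of_eq fun x => by simp

theorem primrec_filter {f : α → List β} {p : α → β → Prop} [DecidableRel p] (hf : Primrec f)
    (hp : PrimrecRel p) : Primrec fun a => (f a).filter fun b => p a b :=
  (Primrec.list_flatMap hf (Primrec.ite hp
    (Primrec.list_cons.comp .snd (.const [])) (.const [])).to₂).of_eq fun a => by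
      induction f a with
      | nil => rfl
      | cons b l ih => by_cases h : p a b <;> simp [h, ih]

theorem primrecPred_pairwise {p : β → β → Prop} (hp : PrimrecRel p) :
    PrimrecPred fun l : List β => l.Pairwise p := by
  classical
  let step : List β → β × List β × Bool → Bool :=
    fun _ x => decide ((∀ b ∈ x.2.1, p x.1 b) ∧ x.2.2 = true)
  have hstep : Primrec₂ step := by
    refine PrimrecPred.decide (.and ?_ ?_)
    · exact primrecPred_forall_mem (Primrec.fst.comp (Primrec.snd.comp .snd))
        (hp.comp (Primrec.fst.comp (Primrec.snd.comp .fst)) .snd)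
    · exact Primrec.eq.comp (Primrec.snd.comp (Primrec.snd.comp .snd)) (.const true)
  refine Primrec.primrecPred ((Primrec.list_rec .id (.const true) hstep).of_eq fun l => ?_)
  induction l with
  | nil => simp
  | cons b l ih =>
    change decide (_ ∧ _ = true) = _
    rw [Bool.eq_iff_iff, decide_eq_true_iff, decide_eq_true_iff, List.pairwise_cons]
    refine and_congr Iff.rfl ?_
    exact (Bool.eq_iff_iff.1 ih).trans (by simp)

theorem primrec_pow_two : Primrec fun n : ℕ => 2 ^ n :=
  (Primrec₂.unpaired'.1 Nat.Primrec.pow).comp (.const 2) .id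

theorem primrec_listsOver : Primrec₂ (listsOver : List β → ℕ → List (List β)) := by
  refine (Primrec.nat_rec (f := fun _ : List β => ([[]] : List (List β)))
    (g := fun l x => [] :: l.flatMap fun b => x.2.map (b :: ·)) (.const _) ?_).of_eq fun l n => ?_
  · refine Primrec.list_cons.comp (.const []) (Primrec.list_flatMap .fst ?_)
    exact Primrec.list_map (Primrec.snd.comp (Primrec.snd.comp .fst))
      (Primrec.list_cons.comp (Primrec.snd.comp .fst) .snd)
  · induction n with
    | zero => rfl
    | succ n ih => simp only [listsOver, ← ih]

end Primrec

theorem primrec_lhs : Primrec Rule.lhs := Primrec.fst.comp (Primrec.of_equiv (e := Rule.equivProd))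

theorem primrec_op : Primrec Rule.op :=
  Primrec.fst.comp (Primrec.snd.comp (Primrec.of_equiv (e := Rule.equivProd)))

theorem primrec_rhs₁ : Primrec Rule.rhs₁ :=
  Primrec.fst.comp (Primrec.snd.comp (Primrec.snd.comp (Primrec.of_equiv (e := Rule.equivProd))))

theorem primrec_rhs₂ : Primrec Rule.rhs₂ :=
  Primrec.snd.comp (Primrec.snd.comp (Primrec.snd.comp (Primrec.of_equiv (e := Rule.equivProd))))

theorem primrecRel_feeds : PrimrecRel Feeds :=
  PrimrecPred.or (Primrec.eq.comp (primrec_lhs.comp .fst) (primrec_rhs₁.comp .snd))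
    (Primrec.eq.comp (primrec_lhs.comp .fst) (primrec_rhs₂.comp .snd))

theorem primrecRel_isRuleOrder : PrimrecRel IsRuleOrder := by
  refine .and (.and ?_ ?_) (.and ?_ ?_)
  · exact primrecPred_forall_mem .snd (primrecRel_mem.comp .snd (Primrec.fst.comp .fst))
  · exact primrecPred_forall_mem .fst (primrecRel_mem.comp .snd (Primrec.snd.comp .fst))
  · have h : PrimrecRel fun δ δ' : Rule => δ ≠ δ' ∧ ¬ Feeds δ' δ :=
      .and (.not Primrec.eq) (.not primrecRel_feeds.swap)
    exact (primrecPred_pairwise h).comp .snd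
  · exact primrecPred_forall_mem .snd (.not (primrecRel_feeds.comp .snd .snd))

/-- An identifier with two timestamps, as the encoding of an interval. -/
abbrev Triple : Type := Ident × ℕ × ℕ

/-- The triple of an interval. -/
def Interval.triple (i : Interval) : Triple := (i.id, i.s, i.e)

theorem Interval.triple_injective : Function.Injective Interval.triple := by
  rintro ⟨_, _, _, _⟩ ⟨_, _, _, _⟩ h
  simp only [triple, Prod.mk.injEq] at h
  obtain ⟨rfl, rfl, rfl⟩ := h
  rfl

/-- The clock predicates of inclusive rules, on triples. -/
def InclCond (o : InclOp ⊕ ExclOp) (i i₁ i₂ : Triple) : Prop :=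
  (o = .inl .before ∧ i₁.2.2 < i₂.2.1 ∧ i.2.1 = i₁.2.1 ∧ i.2.2 = i₂.2.2) ∨
  (o = .inl .meet ∧ i₁.2.2 = i₂.2.1 ∧ i.2.1 = i₁.2.1 ∧ i.2.2 = i₂.2.2) ∨
  (o = .inl .during ∧ i₂.2.1 = i.2.1 ∧ i.2.1 ≤ i₁.2.1 ∧ i₁.2.2 ≤ i₂.2.2 ∧ i₂.2.2 = i.2.2) ∨
  (o = .inl .coincide ∧ i₁.2.1 = i₂.2.1 ∧ i₂.2.1 = i.2.1 ∧ i₁.2.2 = i₂.2.2 ∧ i₂.2.2 = i.2.2) ∨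
  (o = .inl .start ∧ i₁.2.1 = i₂.2.1 ∧ i₂.2.1 = i.2.1 ∧ i.2.2 = max i₁.2.2 i₂.2.2) ∨
  (o = .inl .finish ∧ i.2.2 = i₁.2.2 ∧ i₁.2.2 = i₂.2.2 ∧ i.2.1 = min i₁.2.1 i₂.2.1) ∨
  (o = .inl .overlap ∧ i₁.2.1 < i₂.2.2 ∧ i₂.2.1 < i₁.2.2 ∧ i.2.1 = min i₁.2.1 i₂.2.1 ∧
    i.2.2 = max i₁.2.2 i₂.2.2) ∨
  (o = .inl .slice ∧ i₁.2.1 < i₂.2.2 ∧ i₂.2.1 < i₁.2.2 ∧ i.2.1 = max i₁.2.1 i₂.2.1 ∧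
    i.2.2 = min i₁.2.2 i₂.2.2)

/-- The clock predicates of exclusive rules, on triples. -/
def ExclCond (o : InclOp ⊕ ExclOp) (i₁ i₂ : Triple) : Prop :=
  (o = .inr .after ∧ i₂.2.2 < i₁.2.1) ∨ (o = .inr .follow ∧ i₁.2.1 = i₂.2.2) ∨
  (o = .inr .contain ∧ i₁.2.1 ≤ i₂.2.1 ∧ i₂.2.2 ≤ i₁.2.2)

theorem inclCond_triple {op : InclOp} {i i₁ i₂ : Interval} :
    InclCond (.inl op) i.triple i₁.triple i₂.triple ↔ op.holds i i₁ i₂ := by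
  cases op <;> simp [InclCond, InclOp.holds, Interval.triple]

theorem exclCond_triple {op : ExclOp} {i₁ i₂ : Interval} :
    ExclCond (.inr op) i₁.triple i₂.triple ↔ op.holds i₁ i₂ := by
  cases op <;> simp [ExclCond, ExclOp.holds, Interval.triple]

/-- The rule `δ` produces the triple `i` from the list of triples `P`. -/
def Fires (δ : Rule) (P : List Triple) (i : Triple) : Prop :=
  (∃ i₁ ∈ P, ∃ i₂ ∈ P, i.1 = δ.lhs ∧ i₁.1 = δ.rhs₁ ∧ i₂.1 = δ.rhs₂ ∧ InclCond δ.op i i₁ i₂) ∨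
  ((δ.op = .inr .after ∨ δ.op = .inr .follow ∨ δ.op = .inr .contain) ∧
    ∃ i₁ ∈ P, i.1 = δ.lhs ∧ i₁.1 = δ.rhs₁ ∧ i.2.1 = i₁.2.1 ∧ i.2.2 = i₁.2.2 ∧
      ¬ ∃ i₂ ∈ P, i₂ ≠ i₁ ∧ i₂.1 = δ.rhs₂ ∧ ExclCond δ.op i₁ i₂)

/-- The list `P` contains exactly the triples of the intervals of `π`. -/
def Represents (P : List Triple) (π : Pool) : Prop := ∀ t, t ∈ P ↔ ∃ i ∈ π, i.triple = t

theorem Represents.exists_iff {P : List Triple} {π : Pool} (h : Represents P π)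
    {p : Triple → Prop} : (∃ t ∈ P, p t) ↔ ∃ i ∈ π, p i.triple := by
  constructor
  · rintro ⟨t, ht, hp⟩
    obtain ⟨i, hi, rfl⟩ := (h t).1 ht
    exact ⟨i, hi, hp⟩
  · rintro ⟨i, hi, hp⟩
    exact ⟨_, (h _).2 ⟨i, hi, rfl⟩, hp⟩

theorem Represents.fires_iff {P : List Triple} {π : Pool} (h : Represents P π) (δ : Rule)
    (i : Interval) : Fires δ P i.triple ↔ i ∈ ruleSem δ π := by
  unfold Fires ruleSem
  simp only [h.exists_iff, Interval.triple_injective.ne_iff]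
  obtain ⟨lhs, op | op, rhs₁, rhs₂⟩ := δ
  · simp only [inclCond_triple, reduceCtorEq, or_self, false_and, or_false]
    rfl
  · have h1 : ∀ i i₁ i₂, ¬ InclCond (.inr op) i i₁ i₂ := by
      simp [InclCond]
    have h2 : (Sum.inr op : InclOp ⊕ ExclOp) = .inr .after ∨
        (Sum.inr op : InclOp ⊕ ExclOp) = .inr .follow ∨
        (Sum.inr op : InclOp ⊕ ExclOp) = .inr .contain := by
      cases op <;> simp
    simp only [exclCond_triple, h1, h2, and_false, exists_false, false_or, true_and]
    rfl

open Classical in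
/-- The triples after one application of `δ`; the endpoints of new intervals are sought in `T`. -/
noncomputable def applyRule (T : List ℕ) (P : List Triple) (δ : Rule) : List Triple :=
  P ++ (T.flatMap fun s => T.map fun e => (δ.lhs, s, e)).filter
    fun i => i.2.1 ≤ i.2.2 ∧ Fires δ P i

theorem Represents.applyRule {T : List ℕ} {P : List Triple} {π : Pool} (h : Represents P π)
    (hπ : EndpointsIn {t | t ∈ T} π) (δ : Rule) :
    Represents (applyRule T P δ) (π ∪ ruleSem δ π) := by
  intro t
  have key : t ∈ (T.flatMap fun s => T.map fun e => (δ.lhs, s, e)) ∧ (t.2.1 ≤ t.2.2 ∧ Fires δ P t) ↔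
      ∃ i ∈ ruleSem δ π, i.triple = t := by
    constructor
    · rintro ⟨-, hle, hf⟩
      exact ⟨⟨t.1, t.2.1, t.2.2, hle⟩, (h.fires_iff δ ⟨t.1, t.2.1, t.2.2, hle⟩).1 hf, rfl⟩
    · rintro ⟨i, hi, rfl⟩
      have hf := (h.fires_iff δ i).2 hi
      have hends := hπ.union_ruleSem δ i (Or.inr hi)
      have hid : i.id = δ.lhs := by
        rcases hf with ⟨_, _, _, _, h, _⟩ | ⟨_, _, _, h, _⟩ <;> exact h
      refine ⟨?_, i.s_le_e, hf⟩
      simp only [List.mem_flatMap, List.mem_map]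
      exact ⟨i.s, hends.1, i.e, hends.2, by rw [← hid]; rfl⟩
  simp only [Nfer.applyRule, List.mem_append, List.mem_filter, decide_eq_true_eq, key, h t,
    Set.mem_union, or_and_right, exists_or]

/-- The triples produced by the rules of `L`, applied once each, in order, to the events of `τ`. -/
noncomputable def evalRules (L : List Rule) (τ : List Event) : List Triple :=
  L.foldl (applyRule (τ.map Prod.snd)) (τ.map fun ev => (ev.1, ev.2, ev.2))

theorem represents_evalRules (L : List Rule) (τ : List Event) :
    Represents (evalRules L τ) (listSem L (eventPool {ev | ev ∈ τ})) := by
  have H : ∀ (L : List Rule) (P : List Triple) (π : Pool), Represents P π →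
      EndpointsIn {t | t ∈ τ.map Prod.snd} π →
      Represents (L.foldl (applyRule (τ.map Prod.snd)) P) (listSem L π) := by
    intro L
    induction L with
    | nil => exact fun P π h _ => h
    | cons δ L ih => exact fun P π h hπ => ih _ _ (h.applyRule hπ δ) (hπ.union_ruleSem δ)
  apply H
  · intro t
    simp only [List.mem_map, eventPool]
    constructor
    · rintro ⟨ev, hev, rfl⟩
      exact ⟨_, ⟨ev, hev, rfl⟩, rfl⟩
    · rintro ⟨_, ⟨ev, hev, rfl⟩, rfl⟩
      exact ⟨ev, hev, rfl⟩
  · rintro _ ⟨ev, hev, rfl⟩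
    have : ev.2 ∈ τ.map Prod.snd := List.mem_map_of_mem hev
    exact ⟨this, this⟩

section Primrec

variable {α : Type*} [Primcodable α] {o : α → InclOp ⊕ ExclOp} {i i₁ i₂ : α → Triple}

theorem primrecPred_inclCond (ho : Primrec o) (hi : Primrec i) (h₁ : Primrec i₁)
    (h₂ : Primrec i₂) : PrimrecPred fun a => InclCond (o a) (i a) (i₁ a) (i₂ a) := by
  have s := Primrec.fst.comp (Primrec.snd.comp hi)
  have e := Primrec.snd.comp (Primrec.snd.comp hi)
  have s₁ := Primrec.fst.comp (Primrec.snd.comp h₁)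
  have e₁ := Primrec.snd.comp (Primrec.snd.comp h₁)
  have s₂ := Primrec.fst.comp (Primrec.snd.comp h₂)
  have e₂ := Primrec.snd.comp (Primrec.snd.comp h₂)
  have op := fun c => Primrec.eq.comp ho (.const c)
  refine .or (.and (op _) ?_) (.or (.and (op _) ?_) (.or (.and (op _) ?_) (.or (.and (op _) ?_)
    (.or (.and (op _) ?_) (.or (.and (op _) ?_) (.or (.and (op _) ?_) (.and (op _) ?_)))))))
  · exact .and (Primrec.nat_lt.comp e₁ s₂) (.and (Primrec.eq.comp s s₁) (Primrec.eq.comp e e₂))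
  · exact .and (Primrec.eq.comp e₁ s₂) (.and (Primrec.eq.comp s s₁) (Primrec.eq.comp e e₂))
  · exact .and (Primrec.eq.comp s₂ s) (.and (Primrec.nat_le.comp s s₁)
      (.and (Primrec.nat_le.comp e₁ e₂) (Primrec.eq.comp e₂ e)))
  · exact .and (Primrec.eq.comp s₁ s₂) (.and (Primrec.eq.comp s₂ s)
      (.and (Primrec.eq.comp e₁ e₂) (Primrec.eq.comp e₂ e)))
  · exact .and (Primrec.eq.comp s₁ s₂) (.and (Primrec.eq.comp s₂ s)
      (Primrec.eq.comp e (Primrec.nat_max.comp e₁ e₂)))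
  · exact .and (Primrec.eq.comp e e₁) (.and (Primrec.eq.comp e₁ e₂)
      (Primrec.eq.comp s (Primrec.nat_min.comp s₁ s₂)))
  · exact .and (Primrec.nat_lt.comp s₁ e₂) (.and (Primrec.nat_lt.comp s₂ e₁)
      (.and (Primrec.eq.comp s (Primrec.nat_min.comp s₁ s₂))
        (Primrec.eq.comp e (Primrec.nat_max.comp e₁ e₂))))
  · exact .and (Primrec.nat_lt.comp s₁ e₂) (.and (Primrec.nat_lt.comp s₂ e₁)
      (.and (Primrec.eq.comp s (Primrec.nat_max.comp s₁ s₂))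
        (Primrec.eq.comp e (Primrec.nat_min.comp e₁ e₂))))

theorem primrecPred_exclCond (ho : Primrec o) (h₁ : Primrec i₁) (h₂ : Primrec i₂) :
    PrimrecPred fun a => ExclCond (o a) (i₁ a) (i₂ a) := by
  have s₁ := Primrec.fst.comp (Primrec.snd.comp h₁)
  have e₁ := Primrec.snd.comp (Primrec.snd.comp h₁)
  have s₂ := Primrec.fst.comp (Primrec.snd.comp h₂)
  have e₂ := Primrec.snd.comp (Primrec.snd.comp h₂)
  have op := fun c => Primrec.eq.comp ho (.const c)
  exact .or (.and (op _) (Primrec.nat_lt.comp e₂ s₁))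
    (.or (.and (op _) (Primrec.eq.comp s₁ e₂))
      (.and (op _) (.and (Primrec.nat_le.comp s₁ s₂) (Primrec.nat_le.comp e₂ e₁))))

theorem primrecPred_fires {δ : α → Rule} {P : α → List Triple} (hδ : Primrec δ) (hP : Primrec P)
    (hi : Primrec i) : PrimrecPred fun a => Fires (δ a) (P a) (i a) := by
  have op := primrec_op.comp hδ
  have isOp := fun c => Primrec.eq.comp op (.const c)
  have s := Primrec.fst.comp (Primrec.snd.comp hi)
  have e := Primrec.snd.comp (Primrec.snd.comp hi)
  have lhs := Primrec.eq.comp (Primrec.fst.comp hi) (primrec_lhs.comp hδ)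
  refine .or (primrecPred_exists_mem hP (primrecPred_exists_mem (hP.comp .fst) ?_))
    (.and (.or (isOp _) (.or (isOp _) (isOp _))) (primrecPred_exists_mem hP
      (.and (lhs.comp .fst) (.and ?_ (.and ?_ (.and ?_
        (.not (primrecPred_exists_mem (hP.comp .fst) ?_))))))))
  · have a : Primrec fun x : (α × Triple) × Triple => x.1.1 := Primrec.fst.comp .fst
    have i₁ : Primrec fun x : (α × Triple) × Triple => x.1.2 := Primrec.snd.comp .fst
    exact .and (lhs.comp a)
      (.and (Primrec.eq.comp (Primrec.fst.comp i₁) (primrec_rhs₁.comp (hδ.comp a)))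
        (.and (Primrec.eq.comp (Primrec.fst.comp .snd) (primrec_rhs₂.comp (hδ.comp a)))
          (primrecPred_inclCond (op.comp a) (hi.comp a) i₁ .snd)))
  · exact Primrec.eq.comp (Primrec.fst.comp .snd) (primrec_rhs₁.comp (hδ.comp .fst))
  · exact Primrec.eq.comp (s.comp .fst) (Primrec.fst.comp (Primrec.snd.comp .snd))
  · exact Primrec.eq.comp (e.comp .fst) (Primrec.snd.comp (Primrec.snd.comp .snd))
  · have a : Primrec fun x : (α × Triple) × Triple => x.1.1 := Primrec.fst.comp .fst
    have i₁ : Primrec fun x : (α × Triple) × Triple => x.1.2 := Primrec.snd.comp .fst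
    exact .and (.not (Primrec.eq.comp .snd i₁))
      (.and (Primrec.eq.comp (Primrec.fst.comp .snd) (primrec_rhs₂.comp (hδ.comp a)))
        (primrecPred_exclCond (op.comp a) i₁ .snd))

theorem primrec_applyRule {T : α → List ℕ} {P : α → List Triple} {δ : α → Rule} (hT : Primrec T)
    (hP : Primrec P) (hδ : Primrec δ) : Primrec fun a => applyRule (T a) (P a) (δ a) := by
  classical
  refine Primrec.list_append.comp hP ((primrec_filter
    (f := fun a => (T a).flatMap fun s => (T a).map fun e => ((δ a).lhs, s, e))
    (p := fun a i => i.2.1 ≤ i.2.2 ∧ Fires (δ a) (P a) i) ?_ ?_).of_eq fun a => ?_)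
  · exact Primrec.list_flatMap hT (Primrec.list_map (hT.comp .fst)
      (Primrec.pair (primrec_lhs.comp (hδ.comp (Primrec.fst.comp .fst)))
        (Primrec.pair (Primrec.snd.comp .fst) .snd)))
  · exact .and (Primrec.nat_le.comp (Primrec.fst.comp (Primrec.snd.comp .snd))
      (Primrec.snd.comp (Primrec.snd.comp .snd)))
      (primrecPred_fires (hδ.comp .fst) (hP.comp .fst) .snd)
  · congr

theorem primrec_evalRules : Primrec₂ evalRules := by
  have init : Primrec fun x : List Rule × List Event =>
      x.2.map fun ev => ((ev.1, ev.2, ev.2) : Triple) :=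
    Primrec.list_map .snd (Primrec.pair (Primrec.fst.comp .snd)
      (Primrec.pair (Primrec.snd.comp .snd) (Primrec.snd.comp .snd)))
  have ends : Primrec fun x : List Rule × List Event => x.2.map Prod.snd :=
    Primrec.list_map .snd (Primrec.snd.comp .snd)
  have step : Primrec₂ fun (x : List Rule × List Event) (y : List Triple × Rule) =>
      applyRule (x.2.map Prod.snd) y.1 y.2 :=
    primrec_applyRule (ends.comp .fst) (Primrec.fst.comp .snd) (Primrec.snd.comp .snd)
  exact Primrec.list_foldl .fst init step

end Primrec

/-! ### The decision procedure -/

theorem primrec_numTypes {α : Type*} [Primcodable α] {K n k : α → ℕ} (hK : Primrec K)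
    (hn : Primrec n) (hk : Primrec k) : Primrec fun a => numTypes (K a) (n a) (k a) := by
  have base : Primrec fun a => 2 ^ (K a * K a) * 2 ^ (K a * n a) :=
    Primrec.nat_mul.comp (primrec_pow_two.comp (Primrec.nat_mul.comp hK hK))
      (primrec_pow_two.comp (Primrec.nat_mul.comp hK hn))
  refine (Primrec.nat_rec' (h := fun a x => 2 ^ (K a * K a) * 2 ^ (K a * n a) * 2 ^ x.2) hk base
    (Primrec.nat_mul.comp (base.comp .fst)
      (primrec_pow_two.comp (Primrec.snd.comp .snd)))).of_eq fun a => ?_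
  induction k a with
  | zero => rfl
  | succ k ih => simp only [numTypes, ← ih]

/-- All events with identifiers in `A` and timestamps less than `n`. -/
def eventsBelow (A : List Ident) (n : ℕ) : List Event :=
  (List.range n).flatMap fun t => A.map fun η => (η, t)

theorem mem_eventsBelow {A : List Ident} {n : ℕ} {ev : Event} :
    ev ∈ eventsBelow A n ↔ ev.1 ∈ A ∧ ev.2 < n := by
  obtain ⟨η, t⟩ := ev
  simp only [eventsBelow, List.mem_flatMap, List.mem_range, List.mem_map, Prod.mk.injEq]
  constructor
  · rintro ⟨t, ht, η, hη, rfl, rfl⟩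
    exact ⟨hη, ht⟩
  · rintro ⟨hη, ht⟩
    exact ⟨t, ht, η, hη, rfl, rfl⟩

theorem primrec_eventsBelow : Primrec₂ eventsBelow :=
  Primrec.list_flatMap (Primrec.list_range.comp .snd)
    (Primrec.list_map (Primrec.fst.comp .fst) (Primrec.pair .snd (Primrec.snd.comp .fst)))

/-- The finite set of events that suffice for models of a specification with `d` rules. -/
def modelEvents (d : ℕ) (A : List Ident) : List Event :=
  eventsBelow A (numTypes (4 * d + 2) A.length (4 * d + 2))

theorem primrec_modelEvents : Primrec₂ modelEvents := by
  have k : Primrec fun x : ℕ × List Ident => 4 * x.1 + 2 :=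
    Primrec.nat_add.comp (Primrec.nat_mul.comp (.const 4) .fst) (.const 2)
  exact primrec_eventsBelow.comp .snd (primrec_numTypes k (Primrec.list_length.comp .snd) k)

/-- Satisfiability is decided by a bounded search for an order of the rules and a list of events. -/
theorem cycleFree_and_satisfiable_iff_bounded (D : Spec) (A : List Ident) (η : Ident) :
    CycleFree D ∧ Satisfiable D A η ↔
      ∃ L ∈ listsOver D D.length, IsRuleOrder D L ∧
        ∃ τ ∈ listsOver (modelEvents D.length A) (modelEvents D.length A).length,
          τ ≠ [] ∧ ∃ i ∈ evalRules L τ, i.1 = η := by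
  classical
  rw [cycleFree_and_satisfiable_iff]
  simp only [(represents_evalRules _ _).exists_iff]
  constructor
  · rintro ⟨L, hL, τ, hne, hA, hi⟩
    have hlen : L.length ≤ D.length :=
      (List.subperm_of_subset hL.nodup hL.1.1).length_le
    refine ⟨L, mem_listsOver.2 ⟨hlen, hL.1.1⟩, hL, ?_⟩
    have hfin : (times {ev | ev ∈ τ}).Finite :=
      (List.finite_toSet (τ.map Prod.snd)).subset fun t ⟨η, h⟩ => List.mem_map.2 ⟨_, h, rfl⟩
    obtain ⟨E, ⟨ev, hev⟩, hE, hbf⟩ := exists_backForth_times_lt (A := A) (E := {ev | ev ∈ τ})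
      hA hfin (List.exists_mem_of_ne_nil τ hne) (4 * D.length + 2)
    let σ := (modelEvents D.length A).filter (· ∈ E)
    have hσ : {ev | ev ∈ σ} = E := by
      ext ev
      simp only [σ, Set.mem_ofPred_eq, List.mem_filter, decide_eq_true_eq]
      exact and_iff_right_of_imp fun h => mem_eventsBelow.2 (hE ev h)
    refine ⟨σ, mem_listsOver.2 ⟨List.length_filter_le _ _, fun ev h => (List.mem_filter.1 h).1⟩,
      List.ne_nil_of_mem (hσ ▸ hev : ev ∈ {ev | ev ∈ σ}), ?_⟩
    rw [hσ]
    exact exists_mem_listSem_of_backForth (by omega) hbf hi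
  · rintro ⟨L, -, hL, τ, hτ, hne, hi⟩
    exact ⟨L, hL, τ, hne, fun ev h => (mem_eventsBelow.1 ((mem_listsOver.1 hτ).2 ev h)).1, hi⟩

theorem primrecPred_cycleFree_and_satisfiable :
    PrimrecPred fun x : Spec × List Ident × Ident =>
      CycleFree x.1 ∧ Satisfiable x.1 x.2.1 x.2.2 := by
  have model : Primrec fun x : Spec × List Ident × Ident => modelEvents x.1.length x.2.1 :=
    primrec_modelEvents.comp (Primrec.list_length.comp .fst) (Primrec.fst.comp .snd)
  refine PrimrecPred.of_eq ?_ fun x => (cycleFree_and_satisfiable_iff_bounded _ _ _).symm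
  refine primrecPred_exists_mem
    (primrec_listsOver.comp .fst (Primrec.list_length.comp .fst))
    (.and (primrecRel_isRuleOrder.comp (Primrec.fst.comp .fst) .snd) ?_)
  refine primrecPred_exists_mem
    (primrec_listsOver.comp (model.comp .fst) (Primrec.list_length.comp (model.comp .fst)))
    (.and (.not (Primrec.eq.comp .snd (.const []))) ?_)
  exact primrecPred_exists_mem (primrec_evalRules.comp (Primrec.snd.comp .fst) .snd)
    (Primrec.eq.comp (Primrec.fst.comp .snd)
      (Primrec.snd.comp (Primrec.snd.comp (Primrec.fst.comp (Primrec.fst.comp .fst)))))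

end Nfer

theorem theorem3 :
    ComputablePred fun x : Nfer.Spec × List Nfer.Ident × Nfer.Ident =>
      Nfer.CycleFree x.1 ∧ Nfer.Satisfiable x.1 x.2.1 x.2.2 := by
  obtain ⟨hd, h⟩ := Nfer.primrecPred_cycleFree_and_satisfiable
  exact ⟨hd, h.to_comp⟩
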